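/- For integers $n \ge 1$, $1\le k\le n$ and $1\le r\le n$, a $k$-partition of an $n$-element set $X$ is a partition of $X$ into exactly $k$ nonempty classes, and an $r$-element set $H\subseteq X$ crosses a $k$-partition if $H$ intersects exactly $\min(r,k)$ of its classes. Let $f(n,k,r)$ be the minimum number of edges in an $r$-uniform set system $\mathcal H$ over an $n$-element set $X$ such that every $k$-partition of $X$ is crossed by at least one $H\in\mathcal H$. For a family $\mathfrak F$ of graphs, let $\mathrm{ex}(n,\mathfrak F)$ be the maximum number of edges in a simple graph on $n$ vertices that contains no (not necessarily induced) subgraph isomorphic to a member of $\mathfrak F$. Let $K_m$ be the complete graph on $m$ vertices, and let $K_{2s}-sK_2$ be $K_{2s}$ with the edges of a perfect matching removed. **Proposition.** Let $s\ge 2$ be a fixed integer. Then (i) for every integer $n>s$, $$f(n,n-s,n-2)=\binom n2-\mathrm{ex}\bigl(n,\{K_{s+1},\,K_{2s}-sK_2\}\bigr);$$ (ii) $f(n,n-s,n-2)=\dfrac{1}{2s-2}\,n^2+o(n^2)$ as $n\to\infty$. -/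

import Mathlib

namespace PartitionCrossing

/-- `H` crosses the partition `P` (into nonempty classes) of `X` if it meets exactly
`min (r, k)` classes of `P`, where `r` is the size of `H` and `k` the number of classes. -/
def Crosses {X : Type*} [Fintype X] [DecidableEq X]
    (H : Finset X) (P : Finpartition (Finset.univ : Finset X)) : Prop :=
  (P.parts.filter (fun B => (H ∩ B).Nonempty)).card = min H.card P.parts.card

/-- The set system `𝓗` crosses every partition of `X` into exactly `k` nonempty classes:
each such partition is crossed by at least one member of `𝓗`. -/
def CrossesAll {X : Type*} [Fintype X] [DecidableEq X]
    (𝓗 : Finset (Finset X)) (k : ℕ) : Prop :=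
  ∀ P : Finpartition (Finset.univ : Finset X), P.parts.card = k → ∃ H ∈ 𝓗, Crosses H P

/-- The numbers of edges of the `r`-uniform set systems over an `n`-element set that cross
all `k`-partitions. -/
def crossingSizes (n k r : ℕ) : Set ℕ :=
  {m | ∃ 𝓗 : Finset (Finset (Fin n)),
    (∀ H ∈ 𝓗, H.card = r) ∧ CrossesAll 𝓗 k ∧ 𝓗.card = m}

/-- `f(n,k,r)`: the minimum number of edges in an `r`-uniform set system over an `n`-element
set that crosses all `k`-partitions of that set. -/
noncomputable def f (n k r : ℕ) : ℕ := sInf (crossingSizes n k r)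

/-- For `n ≥ 1` and `r ≤ n` the minimum defining `f(n,k,r)` is taken over a nonempty set. -/
theorem crossingSizes_nonempty {n k r : ℕ} (hn : 0 < n) (hr : r ≤ n) :
    (crossingSizes n k r).Nonempty := by
  classical
  haveI : Nonempty (Fin n) := ⟨⟨0, hn⟩⟩
  refine ⟨_, Finset.univ.powersetCard r, fun H hH => (Finset.mem_powersetCard.1 hH).2, ?_, rfl⟩
  intro P hP
  have hne : ∀ B ∈ P.parts, ∃ x, x ∈ B := fun B hB => P.nonempty_of_mem_parts hB
  choose! g hg using hne
  have huniq : ∀ B ∈ P.parts, ∀ C ∈ P.parts, ∀ x, x ∈ B → x ∈ C → B = C :=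
    fun B hB C hC x h1 h2 => P.eq_of_mem_parts hB hC h1 h2
  have hinj : Set.InjOn g P.parts := fun B hB C hC h =>
    huniq B hB C hC (g B) (hg B hB) (h ▸ hg C hC)
  rcases le_total r k with h | h
  · obtain ⟨S, hS, hSc⟩ := Finset.exists_subset_card_eq (hP.symm ▸ h)
    have hc : (S.image g).card = r := by
      rw [Finset.card_image_of_injOn (hinj.mono (by exact_mod_cast hS)), hSc]
    refine ⟨S.image g, Finset.mem_powersetCard.2 ⟨Finset.subset_univ _, hc⟩, ?_⟩
    have : P.parts.filter (fun B => (S.image g ∩ B).Nonempty) = S := by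
      ext B
      simp only [Finset.mem_filter]
      constructor
      · rintro ⟨hB, x, hx⟩
        obtain ⟨hx1, hx2⟩ := Finset.mem_inter.1 hx
        obtain ⟨C, hC, rfl⟩ := Finset.mem_image.1 hx1
        rwa [huniq B hB C (hS hC) _ hx2 (hg C (hS hC))]
      · intro hB
        exact ⟨hS hB, g B, Finset.mem_inter.2 ⟨Finset.mem_image_of_mem g hB, hg B (hS hB)⟩⟩
    rw [Crosses, this, hc, hSc, hP, min_eq_left h]
  · have hc : (P.parts.image g).card = k := by rw [Finset.card_image_of_injOn hinj, hP]
    obtain ⟨H, hH, -, hHc⟩ := Finset.exists_subsuperset_card_eq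
      (Finset.subset_univ (P.parts.image g)) (hc.symm ▸ h) (by simpa using hr)
    refine ⟨H, Finset.mem_powersetCard.2 ⟨Finset.subset_univ _, hHc⟩, ?_⟩
    have : P.parts.filter (fun B => (H ∩ B).Nonempty) = P.parts :=
      Finset.filter_true_of_mem fun B hB =>
        ⟨g B, Finset.mem_inter.2 ⟨hH (Finset.mem_image_of_mem g hB), hg B hB⟩⟩
    rw [Crosses, this, hHc, hP, min_eq_right h]

open scoped Classical in
/-- The Turán number `ex(n, 𝔉)` of a family of graphs: the maximum number of edges in a graph
on `n` vertices that contains no (not necessarily induced) subgraph isomorphic to a member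
of `𝔉`. -/
noncomputable def ex (n : ℕ) (𝔉 : Set (Σ W : Type, SimpleGraph W)) : ℕ :=
  (Finset.univ.filter (fun G : SimpleGraph (Fin n) => ∀ F ∈ 𝔉, F.2.Free G)).sup
    (fun G => G.edgeFinset.card)

/-- `sK₂`: the disjoint union of `s` edges. -/
def matchingGraph (s : ℕ) : SimpleGraph (Fin s × Fin 2) where
  Adj u v := u.1 = v.1 ∧ u ≠ v
  symm := ⟨fun _ _ h => ⟨h.1.symm, h.2.symm⟩⟩
  loopless := ⟨fun _ h => h.2 rfl⟩

/-- `K_{2s} - sK₂`: the complete graph on `2s` vertices minus a perfect matching. -/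
def completeMinusMatching (s : ℕ) : SimpleGraph (Fin s × Fin 2) :=
  (⊤ : SimpleGraph (Fin s × Fin 2)) \ matchingGraph s

/-- The family `{K_{s+1}, K_{2s} - sK₂}`. -/
def forbiddenFamily (s : ℕ) : Set (Σ W : Type, SimpleGraph W) :=
  {⟨Fin (s + 1), ⊤⟩, ⟨Fin s × Fin 2, completeMinusMatching s⟩}

end PartitionCrossing

/-!
The sets of size `n - 2` are the complements `V \ {u, v}` of pairs, so an `(n - 2)`-uniform system
is the same thing as a graph `G`, whose edges are the pairs whose complements are *not* in the
system; the sizes of the system and of the edge set of `G` add up to `n.choose 2`. The set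
`V \ {u, v}` crosses a partition into `n - s ≤ n - 2` classes exactly when no class is contained
in `{u, v}`. So a partition is uncrossed exactly when any two points of classes with at least two
elements are adjacent in `G` or form a class.

An uncrossed partition with a single class of size `s + 1` besides singletons is a copy of
`K_{s+1}`, and one with `s` classes of size two besides singletons is a copy of `K_{2s} - sK₂`.
Conversely every uncrossed partition into `n - s` classes produces one of these two graphs
(`crossesAll_of_free`): the `s` points left after removing one representative per class are
pairwise adjacent if they lie in different classes or in a class with three or more elements, and
either their partners or one further representative complete the forbidden subgraph. Hence
`f_add_ex`: minimising the system is maximising the edge number of a graph containing neither.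

For the asymptotics, the graph `K_{2s} - sK₂` is the complete `s`-partite graph with parts of
size two, so the Erdős–Stone theorem bounds the Turán number from above
(`exists_extremalNumber_completeEquipartiteGraph_le`), and the Turán graph with `s - 1` parts,
which contains no `K_s`, bounds it from below (`card_edgeFinset_turanGraph_le_ex`).
-/

namespace PartitionCrossing

open Finset SimpleGraph

section Reduction

variable {V : Type*} [Fintype V] [DecidableEq V]

/-! ### Systems of complements of pairs -/

open scoped Classical in
/-- The set system whose members are the sets `V \ {u, v}`, for `u ≠ v` non-adjacent in `G`. -/
noncomputable def coPairSystem (G : SimpleGraph V) : Finset (Finset V) :=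
  Gᶜ.edgeFinset.image fun e => e.toFinsetᶜ

theorem mem_coPairSystem {G : SimpleGraph V} {H : Finset V} :
    H ∈ coPairSystem G ↔ ∃ u v, Gᶜ.Adj u v ∧ ({u, v} : Finset V)ᶜ = H := by
  classical
  simp only [coPairSystem, mem_image, mem_edgeFinset]
  constructor
  · rintro ⟨e, he, rfl⟩
    induction e with
    | _ u v => exact ⟨u, v, he, by rw [Sym2.toFinset_mk_eq]⟩
  · rintro ⟨u, v, h, rfl⟩
    exact ⟨s(u, v), h, by rw [Sym2.toFinset_mk_eq]⟩

theorem card_of_mem_coPairSystem {G : SimpleGraph V} {H : Finset V} (h : H ∈ coPairSystem G) :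
    H.card = Fintype.card V - 2 := by
  obtain ⟨u, v, huv, rfl⟩ := mem_coPairSystem.1 h
  rw [card_compl, card_pair huv.ne]

theorem card_coPairSystem_add_card_edgeFinset (G : SimpleGraph V) [Fintype G.edgeSet] :
    (coPairSystem G).card + G.edgeFinset.card = (Fintype.card V).choose 2 := by
  classical
  have hinj : Function.Injective fun e : Sym2 V => e.toFinsetᶜ := by
    intro e e' h
    ext x
    rw [← Sym2.mem_toFinset, ← Sym2.mem_toFinset, compl_injective h]
  rw [coPairSystem, card_image_of_injective _ hinj, ← card_edgeFinset_top_eq_card_choose_two,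
    ← card_union_of_disjoint]
  · congr 1
    ext e
    induction e with
    | _ u v =>
      simp only [mem_union, mem_edgeFinset, mem_edgeSet, compl_adj, top_adj]
      exact ⟨fun h => h.elim And.left SimpleGraph.Adj.ne, fun h => by tauto⟩
  · rw [Finset.disjoint_left]
    intro e
    induction e with
    | _ u v => simp +contextual [compl_adj]

/-- Every uniform system of sets of co-size two is the system of a graph. -/
theorem exists_coPairSystem_eq (hV : 2 ≤ Fintype.card V) {𝓗 : Finset (Finset V)}
    (h𝓗 : ∀ H ∈ 𝓗, H.card = Fintype.card V - 2) : ∃ G : SimpleGraph V, coPairSystem G = 𝓗 := by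
  refine ⟨{ Adj := fun u v => u ≠ v ∧ ({u, v} : Finset V)ᶜ ∉ 𝓗
            symm := ⟨fun u v h => ⟨h.1.symm, by rw [pair_comm]; exact h.2⟩⟩
            loopless := ⟨fun _ h => h.1 rfl⟩ }, ?_⟩
  ext H
  rw [mem_coPairSystem]
  constructor
  · rintro ⟨u, v, h, rfl⟩
    rw [compl_adj] at h
    by_contra hH
    exact h.2 ⟨h.1, hH⟩
  · intro hH
    have hc : Hᶜ.card = 2 := by rw [card_compl, h𝓗 H hH]; omega
    obtain ⟨u, v, huv, he⟩ := card_eq_two.1 hc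
    have hH' : ({u, v} : Finset V)ᶜ = H := by rw [← he, compl_compl]
    exact ⟨u, v, (compl_adj ..).2 ⟨huv, fun h => h.2 (hH' ▸ hH)⟩, hH'⟩

/-- If a partition has at most `|V| - 2` classes, then `V \ {u, v}` crosses it when it meets
every class, that is, when `{u, v}` contains no class. -/
theorem crosses_compl_pair_iff {P : Finpartition (univ : Finset V)}
    (hP : P.parts.card ≤ Fintype.card V - 2) {u v : V} (huv : u ≠ v) :
    Crosses ({u, v} : Finset V)ᶜ P ↔ ∀ B ∈ P.parts, ¬ B ⊆ {u, v} := by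
  rw [Crosses, card_compl, card_pair huv, min_eq_right hP, card_filter_eq_iff]
  refine forall₂_congr fun B _ => ?_
  rw [not_subset]
  simp only [Finset.Nonempty, mem_inter, mem_compl]
  exact exists_congr fun x => and_comm

theorem crossesAll_coPairSystem_iff {G : SimpleGraph V} {k : ℕ} (hk : k ≤ Fintype.card V - 2) :
    CrossesAll (coPairSystem G) k ↔ ∀ P : Finpartition (univ : Finset V), P.parts.card = k →
      ∃ u v, Gᶜ.Adj u v ∧ ∀ B ∈ P.parts, ¬ B ⊆ {u, v} := by
  refine forall₂_congr fun P hP => ?_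
  constructor
  · rintro ⟨H, hH, hc⟩
    obtain ⟨u, v, huv, rfl⟩ := mem_coPairSystem.1 hH
    exact ⟨u, v, huv, (crosses_compl_pair_iff (hP.trans_le hk) huv.ne).1 hc⟩
  · rintro ⟨u, v, huv, h⟩
    exact ⟨_, mem_coPairSystem.2 ⟨u, v, huv, rfl⟩,
      (crosses_compl_pair_iff (hP.trans_le hk) huv.ne).2 h⟩

/-! ### Uncrossed partitions and forbidden subgraphs -/

/-- The partition into the nonempty fibres of a map. -/
theorem exists_finpartition_fibers (g : V → V) :
    ∃ P : Finpartition (univ : Finset V), P.parts.card = (univ.image g).card ∧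
      ∀ x, (univ.filter fun y => g y = g x) ∈ P.parts := by
  have hmem : ∀ x, (univ.filter fun y => g y = g x) ∈
      (Finpartition.ofSetoid (Setoid.ker g)).parts := by
    intro x
    have : (univ.filter fun y => g y = g x) = (Finpartition.ofSetoid (Setoid.ker g)).part x := by
      ext y
      rw [Finpartition.mem_part_ofSetoid_iff_rel, mem_filter, Setoid.ker_def]
      simp [eq_comm]
    rw [this]
    exact (Finpartition.part_mem _).2 (mem_univ x)
  refine ⟨Finpartition.ofSetoid (Setoid.ker g), ?_, hmem⟩
  symm
  refine card_bij (fun z _ => univ.filter fun y => g y = z) ?_ ?_ ?_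
  · intro z hz
    obtain ⟨x, -, rfl⟩ := mem_image.1 hz
    exact hmem x
  · intro z hz w hw h
    obtain ⟨x, -, rfl⟩ := mem_image.1 hz
    have : x ∈ univ.filter fun y => g y = w := h ▸ mem_filter.2 ⟨mem_univ x, rfl⟩
    exact (mem_filter.1 this).2
  · intro B hB
    obtain ⟨x, hx⟩ := Finpartition.nonempty_of_mem_parts _ hB
    exact ⟨g x, mem_image_of_mem g (mem_univ x),
      Finpartition.eq_of_mem_parts _ (hmem x) hB (mem_filter.2 ⟨mem_univ x, rfl⟩) hx⟩

/-- A system crossing all partitions into `|V| - s` classes crosses the partition into the fibres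
of a map that moves the points of an `s`-element set `R` out of `R` and fixes all other points. -/
theorem exists_not_adj_of_retraction {G : SimpleGraph V} {s : ℕ} (hs : 2 ≤ s)
    (hG : CrossesAll (coPairSystem G) (Fintype.card V - s)) {R : Finset V} (hR : R.card = s)
    {g : V → V} (hgR : ∀ x ∈ R, g x ∉ R) (hg : ∀ x ∉ R, g x = x) :
    ∃ u v, Gᶜ.Adj u v ∧ ∀ x, ∃ y, g y = g x ∧ y ≠ u ∧ y ≠ v := by
  obtain ⟨P, hP, hfib⟩ := exists_finpartition_fibers g
  have himg : univ.image g = Rᶜ := by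
    ext y
    simp only [mem_image, mem_univ, true_and, mem_compl]
    constructor
    · rintro ⟨x, rfl⟩
      by_cases hx : x ∈ R
      · exact hgR x hx
      · rwa [hg x hx]
    · exact fun hy => ⟨y, hg y hy⟩
  rw [himg, card_compl, hR] at hP
  obtain ⟨u, v, huv, h⟩ := (crossesAll_coPairSystem_iff (by omega)).1 hG P hP
  refine ⟨u, v, huv, fun x => ?_⟩
  obtain ⟨y, hy, hyuv⟩ := not_subset.1 (h _ (hfib x))
  rw [mem_insert, mem_singleton, not_or] at hyuv
  exact ⟨y, (mem_filter.1 hy).2, hyuv⟩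

/-- A copy of `K_{s+1}` becomes an uncrossed partition by taking its vertex set as the only
class with more than one element. -/
theorem top_free_of_crossesAll {G : SimpleGraph V} {s : ℕ} (hs : 2 ≤ s)
    (hG : CrossesAll (coPairSystem G) (Fintype.card V - s)) :
    (⊤ : SimpleGraph (Fin (s + 1))).Free G := by
  rintro ⟨φ⟩
  have hφ : Function.Injective φ := φ.injective
  set R : Finset V := univ.image fun i : Fin s => φ i.succ with hRdef
  have hR : R.card = s := by
    have hinj : Function.Injective fun i : Fin s => φ i.succ := hφ.comp (Fin.succ_injective s)
    rw [hRdef, card_image_of_injective _ hinj, card_univ, Fintype.card_fin]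
  have h0 : φ 0 ∉ R := by
    simp only [hRdef, mem_image, mem_univ, true_and, not_exists]
    exact fun i hi => Fin.succ_ne_zero i (hφ hi)
  obtain ⟨u, v, huv, h⟩ := exists_not_adj_of_retraction hs hG hR
    (g := fun x => if x ∈ R then φ 0 else x) (fun x hx => by simpa [hx] using h0)
    (fun x hx => by simp [hx])
  -- A vertex outside the copy is a class of its own.
  have hmem : ∀ x, (∃ y, (if y ∈ R then φ 0 else y) = (if x ∈ R then φ 0 else x) ∧ y ≠ x) →
      ∃ i, φ i = x := by
    rintro x ⟨y, hy, hyx⟩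
    by_cases hx : x ∈ R
    · obtain ⟨i, -, hi⟩ := mem_image.1 hx
      exact ⟨_, hi⟩
    · rw [if_neg hx] at hy
      split_ifs at hy with hyR
      · exact ⟨0, hy⟩
      · exact absurd hy hyx
  obtain ⟨i, rfl⟩ := hmem u ((h u).imp fun y hy => ⟨hy.1, hy.2.1⟩)
  obtain ⟨j, rfl⟩ := hmem v ((h v).imp fun y hy => ⟨hy.1, hy.2.2⟩)
  rw [compl_adj] at huv
  exact huv.2 (φ.toHom.map_rel (fun hij => huv.1 (congrArg φ hij)))

theorem completeMinusMatching_adj {s : ℕ} {x y : Fin s × Fin 2} :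
    (completeMinusMatching s).Adj x y ↔ x.1 ≠ y.1 := by
  simp only [completeMinusMatching, matchingGraph, sdiff_adj, top_adj]
  constructor
  · exact fun h h1 => h.2 ⟨h1, h.1⟩
  · exact fun h => ⟨fun hxy => h (congrArg Prod.fst hxy), fun h1 => h h1.1⟩

/-- A copy of `K_{2s} - sK₂` becomes an uncrossed partition by taking the `s` pairs of
matched vertices as the classes with more than one element. -/
theorem completeMinusMatching_free_of_crossesAll {G : SimpleGraph V} {s : ℕ} (hs : 2 ≤ s)
    (hG : CrossesAll (coPairSystem G) (Fintype.card V - s)) :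
    (completeMinusMatching s).Free G := by
  rintro ⟨φ⟩
  have hφ : Function.Injective φ := φ.injective
  set R : Finset V := univ.image fun i : Fin s => φ (i, 1) with hRdef
  have hR : R.card = s := by
    have hinj : Function.Injective fun i : Fin s => φ (i, 1) :=
      fun i j h => (Prod.ext_iff.1 (hφ h)).1
    rw [hRdef, card_image_of_injective _ hinj, card_univ, Fintype.card_fin]
  have h0 : ∀ i, φ (i, 0) ∉ R := by
    simp only [hRdef, mem_image, mem_univ, true_and, not_exists]
    exact fun i j hj => by simpa using (Prod.ext_iff.1 (hφ hj)).2
  have hex : ∀ x, ∃ z, (∀ i, x = φ (i, 1) → z = φ (i, 0)) ∧ (x ∉ R → z = x) := by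
    intro x
    by_cases hx : x ∈ R
    · obtain ⟨i, -, rfl⟩ := mem_image.1 hx
      refine ⟨φ (i, 0), fun j hj => ?_, fun h => absurd hx h⟩
      rw [show i = j from (Prod.ext_iff.1 (hφ hj)).1]
    · refine ⟨x, fun i hi => absurd ?_ hx, fun _ => rfl⟩
      exact mem_image.2 ⟨i, mem_univ i, hi.symm⟩
  choose g hg1 hg using hex
  have hgφ : ∀ i a, g (φ (i, a)) = φ (i, 0) := by
    intro i a
    fin_cases a
    · exact hg _ (h0 i)
    · exact hg1 _ i rfl
  have hRi : ∀ x ∈ R, ∃ i, x = φ (i, 1) := fun x hx => by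
    obtain ⟨i, -, hi⟩ := mem_image.1 hx
    exact ⟨i, hi.symm⟩
  obtain ⟨u, v, huv, h⟩ := exists_not_adj_of_retraction hs hG hR (g := g)
    (fun x hx => by obtain ⟨i, rfl⟩ := hRi x hx; rw [hgφ]; exact h0 i) hg
  -- A vertex outside the copy is a class of its own.
  have hmem : ∀ x, (∃ y, g y = g x ∧ y ≠ x) → ∃ i a, φ (i, a) = x := by
    rintro x ⟨y, hy, hyx⟩
    by_cases hx : x ∈ R
    · obtain ⟨i, rfl⟩ := hRi x hx
      exact ⟨i, 1, rfl⟩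
    · rw [hg x hx] at hy
      by_cases hyR : y ∈ R
      · obtain ⟨i, rfl⟩ := hRi y hyR
        exact ⟨i, 0, by rw [← hgφ i 1, hy]⟩
      · exact absurd ((hg y hyR).symm.trans hy) hyx
  obtain ⟨i, a, rfl⟩ := hmem u ((h u).imp fun y hy => ⟨hy.1, hy.2.1⟩)
  obtain ⟨j, b, rfl⟩ := hmem v ((h v).imp fun y hy => ⟨hy.1, hy.2.2⟩)
  rw [compl_adj] at huv
  by_cases hij : i = j
  · subst hij
    -- The class of `φ (i, a)` has only two elements, so it lies inside the pair.
    obtain ⟨y, hy, hya, hyb⟩ := h (φ (i, a))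
    have hab : a ≠ b := fun hab => huv.1 (by rw [hab])
    have hyi : ∃ c, y = φ (i, c) := by
      rw [hgφ] at hy
      by_cases hyR : y ∈ R
      · obtain ⟨k, rfl⟩ := hRi y hyR
        rw [hgφ] at hy
        exact ⟨1, by rw [show k = i from (Prod.ext_iff.1 (hφ hy)).1]⟩
      · exact ⟨0, (hg y hyR).symm.trans hy⟩
    obtain ⟨c, rfl⟩ := hyi
    have hca : c ≠ a := fun hc => hya (by rw [hc])
    have hcb : c ≠ b := fun hc => hyb (by rw [hc])
    omega
  · exact huv.2 (φ.toHom.map_rel (completeMinusMatching_adj.2 hij))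

/-- An uncrossed partition yields a forbidden subgraph. Let `T` contain one representative of
each class, so that `Tᶜ` has `s` points. Points in classes with more than one element are adjacent
unless they form a class. If all classes have at most two elements, then `Tᶜ` and the partners of
its points span `K_{2s} - sK₂`; if some class has three elements, then `Tᶜ` together with the
representative of this class spans `K_{s+1}`. -/
theorem crossesAll_of_free {G : SimpleGraph V} {s : ℕ} (hs : 2 ≤ s) (hsV : s ≤ Fintype.card V)
    (h₁ : (⊤ : SimpleGraph (Fin (s + 1))).Free G) (h₂ : (completeMinusMatching s).Free G) :
    CrossesAll (coPairSystem G) (Fintype.card V - s) := by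
  rw [crossesAll_coPairSystem_iff (by omega)]
  intro P hP
  by_contra! hcon
  obtain ⟨T, -, hT⟩ := P.exists_subset_part_bijOn
  have hself : ∀ x, x ∈ P.part x := fun x => P.mem_part (mem_univ x)
  have hparts : ∀ x, P.part x ∈ P.parts := fun x => P.part_mem.2 (mem_univ x)
  have hpart : ∀ {x y}, y ∈ P.part x → P.part y = P.part x := fun {x y} h =>
    P.part_eq_of_mem (hparts x) h
  -- `r x` is the representative of the class of `x`
  have hrep : ∀ x, ∃ t ∈ T, P.part t = P.part x := fun x => hT.surjOn (hparts x)
  choose r hrT hr using hrep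
  have hTinj : ∀ {t t'}, t ∈ T → t' ∈ T → P.part t = P.part t' → t = t' := fun h h' he =>
    hT.injOn h h' he
  have hTcard : Tᶜ.card = s := by
    have : T.card = P.parts.card := card_nbij P.part hT.mapsTo hT.injOn hT.surjOn
    rw [card_compl, this, hP]
    omega
  have hmem_r : ∀ x, r x ∈ P.part x := fun x => (hr x) ▸ hself (r x)
  have hne : ∀ x ∈ Tᶜ, r x ≠ x := fun x hx h => mem_compl.1 hx (h ▸ hrT x)
  -- Two points of non-singleton classes are adjacent unless they form a class.
  have hadj : ∀ x y, x ≠ y → (∃ z ∈ P.part x, z ≠ x) → (∃ z ∈ P.part y, z ≠ y) →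
      P.part x ≠ {x, y} → G.Adj x y := by
    rintro x y hxy ⟨z, hz, hzx⟩ ⟨w, hw, hwy⟩ hpair
    by_contra hnadj
    obtain ⟨B, hB, hBsub⟩ := hcon x y ((compl_adj ..).2 ⟨hxy, hnadj⟩)
    obtain ⟨b, hb⟩ := P.nonempty_of_mem_parts hB
    have hBx : ∀ {c}, c ∈ B → P.part c = B := fun hc => P.part_eq_of_mem hB hc
    rcases mem_insert.1 (hBsub hb) with rfl | hby
    · rw [← hBx hb] at hBsub
      have hzy : z = y := by simpa [hzx] using hBsub hz
      subst hzy
      refine hpair (Subset.antisymm hBsub fun c hc => ?_)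
      rcases mem_insert.1 hc with rfl | hc
      · exact hself _
      · rwa [mem_singleton.1 hc]
    · rw [mem_singleton] at hby
      subst hby
      rw [← hBx hb] at hBsub
      have hwx : w = x := by simpa [hwy] using hBsub hw
      subst hwx
      refine hpair ?_
      rw [hpart hw]
      refine Subset.antisymm hBsub fun c hc => ?_
      rcases mem_insert.1 hc with rfl | hc
      · exact hw
      · rw [mem_singleton.1 hc]; exact hself _
  have hbig : ∀ x ∈ Tᶜ, ∃ z ∈ P.part x, z ≠ x := fun x hx => ⟨r x, hmem_r x, hne x hx⟩
  by_cases hsmall : ∀ x, (P.part x).card ≤ 2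
  · apply h₂
    let e : Fin s ≃ (Tᶜ : Finset V) := (equivFinOfCardEq hTcard).symm
    have he : ∀ i, (e i : V) ∈ Tᶜ := fun i => (e i).2
    -- Two points of `Tᶜ` in the same class would give, with the representative, three points.
    have hRinj : ∀ i j, P.part (e i : V) = P.part (e j : V) → i = j := by
      intro i j hij
      by_contra hne'
      have h3 : ({(e i : V), (e j : V), r (e i)} : Finset V) ⊆ P.part (e i) := by
        intro c hc
        simp only [mem_insert, mem_singleton] at hc
        rcases hc with rfl | rfl | rfl
        · exact hself _
        · rw [hij]; exact hself _
        · exact hmem_r _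
      have hij' : (e i : V) ≠ e j := fun h => hne' (e.injective (Subtype.ext h))
      have hrj : (e j : V) ≠ r (e i) := fun h => mem_compl.1 (he j) (h ▸ hrT _)
      have := (card_le_card h3).trans (hsmall _)
      rw [card_eq_three.2 ⟨_, _, _, hij', (hne _ (he i)).symm, hrj, rfl⟩] at this
      omega
    let φ : Fin s × Fin 2 → V := fun p => if p.2 = 0 then r (e p.1) else e p.1
    have hφpart : ∀ p, P.part (φ p) = P.part (e p.1 : V) := by
      intro p
      by_cases hp : p.2 = 0
      · simp only [φ, if_pos hp, hr]
      · simp only [φ, if_neg hp]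
    have hφbig : ∀ p, ∃ z ∈ P.part (φ p), z ≠ φ p := by
      intro p
      rw [hφpart]
      by_cases hp : p.2 = 0
      · exact ⟨e p.1, hself _, by simpa only [φ, if_pos hp] using (hne _ (he p.1)).symm⟩
      · simpa only [φ, if_neg hp] using hbig _ (he p.1)
    have hφinj : Function.Injective φ := by
      rintro ⟨i, a⟩ ⟨j, b⟩ h
      have hij : i = j := hRinj i j (by rw [← hφpart (i, a), h, hφpart])
      subst hij
      have := hne _ (he i)
      by_cases ha : a = 0 <;> by_cases hb : b = 0
      · rw [ha, hb]
      · simp only [φ, if_pos ha, if_neg hb] at h; exact absurd h this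
      · simp only [φ, if_neg ha, if_pos hb] at h; exact absurd h.symm this
      · exact Prod.ext rfl (by simp only; omega)
    refine ⟨⟨⟨φ, fun {p q} hpq => ?_⟩, hφinj⟩⟩
    have hpq1 := completeMinusMatching_adj.1 hpq
    refine hadj _ _ (fun h => hpq1 (congrArg Prod.fst (hφinj h))) (hφbig p) (hφbig q) ?_
    intro hpair
    refine hpq1 (hRinj _ _ ?_)
    rw [← hφpart, ← hφpart, ← hpart (y := φ q) (by rw [hpair]; simp)]
  · push Not at hsmall
    obtain ⟨x₀, hx₀⟩ := hsmall
    apply h₁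
    have hcard : (insert (r x₀) Tᶜ).card = s + 1 := by
      rw [card_insert_of_notMem (fun h => mem_compl.1 h (hrT x₀)), hTcard]
    let e : Fin (s + 1) ≃ (insert (r x₀) Tᶜ : Finset V) := (equivFinOfCardEq hcard).symm
    have hbig' : ∀ x ∈ insert (r x₀) Tᶜ, ∃ z ∈ P.part x, z ≠ x := by
      intro x hx
      rcases mem_insert.1 hx with rfl | hx
      · rw [hr]
        exact exists_mem_ne (by omega) _
      · exact hbig x hx
    refine ⟨⟨⟨fun i => (e i : V), fun {i j} hij => ?_⟩,
      fun i j h => e.injective (Subtype.ext h)⟩⟩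
    have hij' : (e i : V) ≠ e j := fun h => hij (e.injective (Subtype.ext h))
    refine hadj _ _ hij' (hbig' _ (e i).2) (hbig' _ (e j).2) fun hpair => ?_
    -- The representative of a two-element class inside `insert (r x₀) Tᶜ` must be `r x₀`.
    have hrmem : r (e i) ∈ insert (r x₀) Tᶜ := by
      have := hmem_r (e i)
      rw [hpair] at this
      rcases mem_insert.1 this with h | h
      · rw [h]; exact (e i).2
      · rw [mem_singleton.1 h]; exact (e j).2
    have hrx₀ : r (e i) = r x₀ := (mem_insert.1 hrmem).resolve_right
      fun h => mem_compl.1 h (hrT _)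
    have : P.part (e i : V) = P.part x₀ := by rw [← hr, hrx₀, hr]
    rw [← this, hpair, card_pair hij'] at hx₀
    omega

theorem crossesAll_coPairSystem_iff_free {G : SimpleGraph V} {s : ℕ} (hs : 2 ≤ s)
    (hsV : s ≤ Fintype.card V) :
    CrossesAll (coPairSystem G) (Fintype.card V - s) ↔ ∀ F ∈ forbiddenFamily s, F.2.Free G := by
  simp only [forbiddenFamily, Set.mem_insert_iff, Set.mem_singleton_iff, forall_eq_or_imp,
    forall_eq]
  exact ⟨fun h => ⟨top_free_of_crossesAll hs h, completeMinusMatching_free_of_crossesAll hs h⟩,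
    fun h => crossesAll_of_free hs hsV h.1 h.2⟩

end Reduction

/-! ### The crossing number and the Turán number -/

theorem card_edgeFinset_le_ex {n : ℕ} {𝔉 : Set (Σ W : Type, SimpleGraph W)}
    {G : SimpleGraph (Fin n)} [Fintype G.edgeSet] (hG : ∀ F ∈ 𝔉, F.2.Free G) :
    G.edgeFinset.card ≤ ex n 𝔉 := by
  classical
  have hmem : G ∈ univ.filter (fun G : SimpleGraph (Fin n) => ∀ F ∈ 𝔉, F.2.Free G) :=
    mem_filter.2 ⟨mem_univ G, hG⟩
  have := Finset.le_sup (f := fun G : SimpleGraph (Fin n) => G.edgeFinset.card) hmem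
  unfold ex
  convert! this

open scoped Classical in
theorem ex_le {n m : ℕ} {𝔉 : Set (Σ W : Type, SimpleGraph W)}
    (h : ∀ G : SimpleGraph (Fin n), (∀ F ∈ 𝔉, F.2.Free G) → G.edgeFinset.card ≤ m) :
    ex n 𝔉 ≤ m :=
  Finset.sup_le fun G hG => h G (mem_filter.1 hG).2

theorem f_add_ex {s n : ℕ} (hs : 2 ≤ s) (hn : s < n) :
    f n (n - s) (n - 2) + ex n (forbiddenFamily s) = n.choose 2 := by
  classical
  have hiff : ∀ G : SimpleGraph (Fin n), CrossesAll (coPairSystem G) (n - s) ↔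
      ∀ F ∈ forbiddenFamily s, F.2.Free G := by
    intro G
    simpa using crossesAll_coPairSystem_iff_free (G := G) hs (by simpa using hn.le)
  have hcount : ∀ G : SimpleGraph (Fin n),
      (coPairSystem G).card + G.edgeFinset.card = n.choose 2 := by
    intro G
    simpa using card_coPairSystem_add_card_edgeFinset G
  obtain ⟨𝓗, h𝓗, hcross, hf⟩ := Nat.sInf_mem
    (crossingSizes_nonempty (n := n) (k := n - s) (r := n - 2) (by omega) (by omega))
  obtain ⟨G, rfl⟩ := exists_coPairSystem_eq (𝓗 := 𝓗) (by rw [Fintype.card_fin]; omega)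
    (by simpa using h𝓗)
  rw [← f] at hf
  have hG := hcount G
  apply le_antisymm
  · have hex : ex n (forbiddenFamily s) ≤ n.choose 2 - f n (n - s) (n - 2) := by
      refine ex_le fun G' hG' => ?_
      have hle : f n (n - s) (n - 2) ≤ (coPairSystem G').card :=
        Nat.sInf_le ⟨coPairSystem G', fun H hH => by simpa using card_of_mem_coPairSystem hH,
          (hiff G').2 hG', rfl⟩
      have hG'' := hcount G'
      omega
    omega
  · rw [← hG, hf]
    gcongr
    exact card_edgeFinset_le_ex ((hiff G).1 hcross)

/-! ### Asymptotics of the Turán number -/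

/-- The edge version of the Erdős–Stone theorem, from its minimum degree version: deleting a
vertex of minimum degree from a large graph without the complete equipartite subgraph destroys
fewer than `(1 - 1 / r + ε) n` edges, and these losses are summed over `n`. -/
theorem exists_extremalNumber_completeEquipartiteGraph_le {r : ℕ} (hr : 1 ≤ r) (t : ℕ) {ε : ℝ}
    (hε : 0 < ε) :
    ∃ C : ℝ, 0 ≤ C ∧ ∀ᶠ n : ℕ in Filter.atTop,
      (extremalNumber n (completeEquipartiteGraph (r + 1) t) : ℝ) ≤
        (1 - 1 / r + ε) * (n * (n + 1) / 2) + C := by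
  obtain ⟨N, hN⟩ := Filter.eventually_atTop.1
    (eventually_completeEquipartiteGraph_isContained_of_minDegree hε r t)
  have hr1 : (1 : ℝ) / r ≤ 1 := by
    rw [div_le_one (by positivity)]
    exact_mod_cast hr
  set c : ℝ := 1 - 1 / r + ε with hc
  have hc0 : 0 ≤ c := by linarith
  refine ⟨extremalNumber N (completeEquipartiteGraph (r + 1) t), by positivity,
    Filter.eventually_atTop.2 ⟨N, fun n hn => ?_⟩⟩
  induction n, hn using Nat.le_induction with
  | base => exact le_add_of_nonneg_left (by positivity)
  | succ n hn ih =>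
    have hcard : extremalNumber (n + 1) (completeEquipartiteGraph (r + 1) t) =
        extremalNumber (Fintype.card (Fin (n + 1))) (completeEquipartiteGraph (r + 1) t) := by
      rw [Fintype.card_fin]
    rw [hcard, extremalNumber_le_iff_of_nonneg _ (by positivity)]
    intro G _ hG
    obtain ⟨v, hv⟩ := G.exists_minimal_degree_vertex
    have hdeg : (G.degree v : ℝ) < c * (n + 1 : ℕ) := by
      rw [← hv]
      by_contra! hge
      exact hG (hN (n + 1) (by omega) hge)
    have hdel := card_edgeFinset_deleteIncidenceSet_le_extremalNumber hG v
    rw [card_edgeFinset_deleteIncidenceSet, Fintype.card_fin, Nat.add_sub_cancel] at hdel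
    have hsum : (G.edgeFinset.card : ℝ) ≤
        extremalNumber n (completeEquipartiteGraph (r + 1) t) + G.degree v := by
      exact_mod_cast Nat.sub_le_iff_le_add.1 hdel
    push_cast at hdeg ⊢
    linarith

theorem completeMinusMatching_eq_completeEquipartiteGraph (s : ℕ) :
    completeMinusMatching s = completeEquipartiteGraph s 2 := by
  ext x y
  rw [completeMinusMatching_adj, completeEquipartiteGraph_adj]

theorem ex_forbiddenFamily_le_extremalNumber (s n : ℕ) :
    ex n (forbiddenFamily s) ≤ extremalNumber n (completeEquipartiteGraph s 2) := by
  classical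
  refine ex_le fun G hG => ?_
  have hfree : (completeEquipartiteGraph s 2).Free G := by
    rw [← completeMinusMatching_eq_completeEquipartiteGraph]
    exact hG ⟨_, completeMinusMatching s⟩ (Or.inr rfl)
  simpa using card_edgeFinset_le_extremalNumber hfree

/-- Both forbidden graphs contain `K_s`, which the Turán graph with `s - 1` parts does not. -/
theorem card_edgeFinset_turanGraph_le_ex {r : ℕ} (hr : 0 < r) (n : ℕ) :
    (turanGraph n r).edgeFinset.card ≤ ex n (forbiddenFamily (r + 1)) := by
  have hfree : ∀ F ∈ forbiddenFamily (r + 1), F.2.Free (turanGraph n r) := by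
    have hK : (⊤ : SimpleGraph (Fin (r + 1))).Free (turanGraph n r) := fun ⟨φ⟩ =>
      (cliqueFree_iff.1 (turanGraph_cliqueFree hr)).false φ
    simp only [forbiddenFamily, Set.mem_insert_iff, Set.mem_singleton_iff, forall_eq_or_imp,
      forall_eq]
    refine ⟨fun h => hK (IsContained.trans ⟨?_⟩ h), fun h => hK (IsContained.trans ⟨?_⟩ h)⟩
    · exact ⟨⟨Fin.castSucc, fun hij => (Fin.castSucc_injective _).ne hij⟩,
        Fin.castSucc_injective _⟩
    · exact ⟨⟨fun i => (i, 0), fun hij => completeMinusMatching_adj.2 hij⟩,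
        fun i j h => (Prod.ext_iff.1 h).1⟩
  exact card_edgeFinset_le_ex hfree

theorem le_card_edgeFinset_turanGraph {r : ℕ} (hr : 0 < r) (n : ℕ) :
    (1 - 1 / r : ℝ) * (n ^ 2 / 2) - (r ^ 2 + 1) ≤ ((turanGraph n r).edgeFinset.card : ℝ) := by
  have hmod : n % r ≤ r := (Nat.mod_lt n hr).le
  have hdiv := Nat.lt_div_mul_add (a := (n ^ 2 - (n % r) ^ 2) * (r - 1))
    (show 0 < 2 * r by omega)
  have hle : (n ^ 2 - (n % r) ^ 2) * (r - 1) / (2 * r) ≤ (turanGraph n r).edgeFinset.card := by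
    rw [card_edgeFinset_turanGraph]
    exact Nat.le_add_right _ _
  have hnat : (n ^ 2 - (n % r) ^ 2) * (r - 1) ≤
      (turanGraph n r).edgeFinset.card * (2 * r) + 2 * r := by
    grw [← hle]
    exact hdiv.le
  have hreal : ((n : ℝ) ^ 2 - ((n % r : ℕ) : ℝ) ^ 2) * (r - 1) ≤
      (turanGraph n r).edgeFinset.card * (2 * r) + 2 * r := by
    rw [← @Nat.cast_le ℝ] at hnat
    push_cast [Nat.cast_sub (Nat.pow_le_pow_left (Nat.mod_le n r) 2),
      Nat.cast_sub (show 1 ≤ r from hr)] at hnat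
    exact hnat
  have hr' : (1 : ℝ) ≤ r := by exact_mod_cast hr
  have hmod' : ((n % r : ℕ) : ℝ) ^ 2 ≤ (r : ℝ) ^ 2 := by
    have : ((n % r : ℕ) : ℝ) ≤ r := by exact_mod_cast hmod
    gcongr
  have h1 : ((n % r : ℕ) : ℝ) ^ 2 * (r - 1) ≤ (r : ℝ) ^ 2 * (r - 1) := by
    gcongr
  have h2 : (r : ℝ) ^ 2 * (r - 1) ≤ r ^ 2 * (2 * r) := by
    gcongr
    linarith
  have hpos : (0 : ℝ) < 2 * r := by linarith
  refine le_of_mul_le_mul_right ?_ hpos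
  have : ((1 - 1 / r : ℝ) * (n ^ 2 / 2) - (r ^ 2 + 1)) * (2 * r) =
      n ^ 2 * (r - 1) - r ^ 2 * (2 * r) - 2 * r := by
    field_simp
    ring
  rw [this]
  linarith

theorem isLittleO_f_sub {s : ℕ} (hs : 2 ≤ s) :
    (fun n : ℕ => (f n (n - s) (n - 2) : ℝ) - 1 / (2 * (s : ℝ) - 2) * (n : ℝ) ^ 2)
      =o[Filter.atTop] fun n : ℕ => (n : ℝ) ^ 2 := by
  obtain ⟨r, rfl⟩ : ∃ r, s = r + 1 := ⟨s - 1, by omega⟩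
  have hr : 0 < r := by omega
  rw [Asymptotics.isLittleO_iff]
  intro δ hδ
  obtain ⟨C, hC, hupper⟩ := exists_extremalNumber_completeEquipartiteGraph_le hr 2 hδ
  filter_upwards [hupper, Filter.eventually_gt_atTop (r + 1),
    Filter.eventually_ge_atTop ⌈(2 + δ + 2 * C) / δ⌉₊,
    Filter.eventually_ge_atTop ⌈((r : ℝ) ^ 2 + 1) / δ⌉₊] with n hup hn hn1 hn2
  have hn1' : 2 + δ + 2 * C ≤ n * δ := (div_le_iff₀ hδ).1 (Nat.ceil_le.1 hn1)
  have hn2' : (r : ℝ) ^ 2 + 1 ≤ n * δ := (div_le_iff₀ hδ).1 (Nat.ceil_le.1 hn2)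
  have hn0 : (1 : ℝ) ≤ n := by exact_mod_cast (by omega : 1 ≤ n)
  have hsum : (f n (n - (r + 1)) (n - 2) : ℝ) + ex n (forbiddenFamily (r + 1)) =
      n * (n - 1) / 2 := by
    rw [← Nat.cast_choose_two, ← f_add_ex hs hn]
    push_cast
    ring
  have hexup : (ex n (forbiddenFamily (r + 1)) : ℝ) ≤
      (1 - 1 / r + δ) * (n * (n + 1) / 2) + C :=
    le_trans (by exact_mod_cast ex_forbiddenFamily_le_extremalNumber _ n) hup
  have hexlow : (1 - 1 / r : ℝ) * (n ^ 2 / 2) - (r ^ 2 + 1) ≤ ex n (forbiddenFamily (r + 1)) :=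
    (le_card_edgeFinset_turanGraph hr n).trans
      (by exact_mod_cast card_edgeFinset_turanGraph_le_ex hr n)
  have hcoef : 1 / (2 * ((r + 1 : ℕ) : ℝ) - 2) = 1 / r / 2 := by
    push_cast
    rw [div_div]
    congr 1
    ring
  have hq0 : (0 : ℝ) ≤ 1 / r := by positivity
  rw [hcoef, Real.norm_eq_abs, Real.norm_eq_abs, abs_of_nonneg (sq_nonneg (n : ℝ)), abs_le]
  generalize (1 : ℝ) / r = q at *
  have hm1 := mul_le_mul_of_nonneg_right hn1' (by linarith : (0 : ℝ) ≤ n)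
  have hm2 := mul_le_mul_of_nonneg_right hn2' (by linarith : (0 : ℝ) ≤ n)
  have hm3 : C ≤ C * n := le_mul_of_one_le_right hC hn0
  have hm4 : (r : ℝ) ^ 2 + 1 ≤ (r ^ 2 + 1) * n := le_mul_of_one_le_right (by positivity) hn0
  have hm5 : 0 ≤ q * n := by positivity
  constructor <;> nlinarith

end PartitionCrossing

theorem mainTheorem4 (s : ℕ) (hs : 2 ≤ s) :
    (∀ n : ℕ, s < n →
      (PartitionCrossing.f n (n - s) (n - 2) : ℤ) =
        (n.choose 2 : ℤ) - (PartitionCrossing.ex n (PartitionCrossing.forbiddenFamily s) : ℤ)) ∧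
    Asymptotics.IsLittleO Filter.atTop
      (fun n : ℕ => (PartitionCrossing.f n (n - s) (n - 2) : ℝ) -
        1 / (2 * (s : ℝ) - 2) * (n : ℝ) ^ 2)
      (fun n : ℕ => (n : ℝ) ^ 2) := by
  refine ⟨fun n hn => ?_, PartitionCrossing.isLittleO_f_sub hs⟩
  rw [← PartitionCrossing.f_add_ex hs hn]
  push_cast
  ring
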